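/- Let $0<n_1<\dots<n_k<n$ be integers, and let $\lambda=(\lambda_1\ge\dots\ge\lambda_n\ge 0)$ be integers with $\lambda_j>\lambda_{j+1}$ (for $1\le j<n$) if and only if $j\in\{n_1,\dots,n_k\}$. Let $X=F\ell_{n_1,\dots,n_k;n}$ be the variety of flags $V_1\subseteq\dots\subseteq V_k\subseteq\mathbb{C}^n$ with $\dim V_i=n_i$, embedded by Plücker coordinates in $\mathbb{P}:=\prod_{i=1}^k\mathbb{P}(\bigwedge^{n_i}\mathbb{C}^n)=\prod_{i=1}^k\mathbb{P}^{\binom{n}{n_i}-1}$, with homogeneous coordinates $p_I$, $I=[i_1<\dots<i_{n_i}]$, $i_r\in\{1,\dots,n\}$. *Polytope.* Let $\Delta\subset\mathbb{R}^{n(n+1)/2}$ be the Gelfand–Cetlin polytope of $\lambda$: the convex hull of all integer arrays $(\lambda^{(i)}_j)_{1\le j\le i\le n}$ with $\lambda^{(n)}_j=\lambda_j$ and $\lambda^{(i+1)}_j\ge\lambda^{(i)}_j\ge\lambda^{(i+1)}_{j+1}$. Let $V$ be its set of vertices and $\Pi_\lambda$ its set of lattice points. *Toric degeneration.* For $I=[i_1,\dots,i_\ell]$,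 $J=[j_1,\dots,j_m]$ with $\ell\ge m$ put $I\wedge J=[\min(i_1,j_1),\dots,\min(i_m,j_m),i_{m+1},\dots,i_\ell]$ and $I\vee J=[\max(i_1,j_1),\dots,\max(i_m,j_m)]$; write $I\le J$ if $\ell\ge m$ and $i_r\le j_r$ for all $r\le m$. Let $X_0\subseteq\mathbb{P}$ be defined by the equations $p_Ip_J=p_{I\vee J}\,p_{I\wedge J}$ for all incomparable pairs $I,J$. *Toric subvarieties.* Set $b_j=\lambda_j-\lambda_{j+1}$ for $1\le j\le n$, where $\lambda_{n+1}:=0$. For $I=[i_1,\dots,i_m]$ let $\beta_I\in\mathbb{Z}^{n(n+1)/2}$ have entry $1$ at the positions $(i,j)=(i_r,r)$, $1\le r\le m$, and $0$ elsewhere, and let $\phi$ send $(b_{i,j})$ to $(b_{j,j}+b_{j+1,j}+\dots+b_{i,j})_{1\le j\le i\le n}$. A monomial $\prod p_I$ with exactly $b_{n_i}$ factors from the $i$-th projective space, $1\le i\le k$, has the lattice point $\phi\big(\sum\beta_I+b_n\beta_{[1,2,\dots,n]}\big)\in\Pi_\lambda$. These monomials embed $X_0$ in $\mathbb{P}(\mathbb{C}^{\Pi_\lambda})$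 (the coordinate at $\chi$ being the value of any monomial with lattice point $\chi$), and identify $X_0$ with the toric variety $X_\Delta\subseteq\mathbb{P}(\mathbb{C}^{\Pi_\lambda})$ of $\Delta$. For a face $F$ of $\Delta$, the toric subvariety $X_{\Delta(F)}\subseteq X_\Delta$ is the closure of the torus orbit of the points whose coordinate at $\chi$ is $t^\chi$ for $\chi\in F$ and $0$ for $\chi\notin F$. For $z\in V$ let $X_0(z)$ be the toric subvariety of $X_0$ that corresponds to the face $\{z\}$, and let $V^X=\{z\in V\mid X_0(z)\in X\}$. A point of a projective space is a coordinate point if exactly one of its homogeneous coordinates is nonzero; a point of a product of projective spaces is a coordinate point if each of its components is one. Then the following hold. 1. If $X=Gr(m,n)$ (that is, $k=1$, $n_1=m$, $0<m<n$), then each $X_0(z)$, $z\in V$, is a single point, $\{X_0(z)\mid z\in V\}$ is exactly the set of coordinate points of $\mathbb{P}^{\binom nm-1}$, and $V^X=V$. 2. For every partial flag variety $X=F\ell_{n_1,\dots,n_k;n}$ and every $z\in V$, $X_0(z)$ is a single point, and it is a coordinate point of $\mathbb{P}^{\binom{n}{n_1}-1}\times\dots\times\mathbb{P}^{\binom{n}{n_k}-1}$.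 -/

import Mathlib

open scoped LinearAlgebra.Projectivization

noncomputable section

namespace GelfandCetlin

/-- The numerical data `0 < n_1 < ⋯ < n_k < n` of a partial flag variety `Fℓ_{n_1, …, n_k; n}`. -/
structure FlagType (k n : ℕ) where
  dim : Fin k → ℕ
  dim_strictMono : StrictMono dim
  dim_pos : ∀ i, 0 < dim i
  dim_lt : ∀ i, dim i < n

/-- The type of the Grassmannian `Gr(m, n) = Fℓ_{m; n}`. -/
def grassmannian (m n : ℕ) (hm : 0 < m) (hmn : m < n) : FlagType 1 n where
  dim := fun _ => m
  dim_strictMono := Subsingleton.strictMono _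
  dim_pos := fun _ => hm
  dim_lt := fun _ => hmn

/-- `lam` is a weakly decreasing sequence `λ_1 ≥ ⋯ ≥ λ_n ≥ 0` of integers that drops strictly
exactly after the positions `n_1, …, n_k`.  Indices are shifted by one: `lam j` is `λ_{j+1}`. -/
structure FlagType.IsWeight {k n : ℕ} (D : FlagType k n) (lam : Fin n → ℕ) : Prop where
  antitone : Antitone lam
  drop_iff : ∀ (j : ℕ) (h : j + 1 < n),
    lam ⟨j + 1, h⟩ < lam ⟨j, Nat.lt_of_succ_lt h⟩ ↔ ∃ i, D.dim i = j + 1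

/-! ### The Gelfand–Cetlin polytope -/

/-- Positions of a triangular array; `(i, j)` with `j ≤ i` stands for the position of
`λ^{(i+1)}_{j+1}`. -/
abbrev GCIndex (n : ℕ) : Type := {p : Fin n × Fin n // p.2 ≤ p.1}

/-- Integer Gelfand–Cetlin patterns for `lam`. -/
structure IsGCPattern {n : ℕ} (lam : Fin n → ℕ) (x : GCIndex n → ℤ) : Prop where
  top : ∀ p : GCIndex n, (p.1.1 : ℕ) + 1 = n → x p = (lam p.1.2 : ℤ)
  le_above : ∀ p q : GCIndex n, (q.1.1 : ℕ) = p.1.1 + 1 → q.1.2 = p.1.2 → x p ≤ x q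
  right_le : ∀ p q : GCIndex n, (q.1.1 : ℕ) = p.1.1 + 1 → (q.1.2 : ℕ) = p.1.2 + 1 → x q ≤ x p

/-- An integer array seen as a real one. -/
def toReal {n : ℕ} (x : GCIndex n → ℤ) : GCIndex n → ℝ := fun p => (x p : ℝ)

/-- The Gelfand–Cetlin polytope `Δ`: the convex hull of all integer patterns. -/
def polytope {n : ℕ} (lam : Fin n → ℕ) : Set (GCIndex n → ℝ) :=
  convexHull ℝ (toReal '' {x | IsGCPattern lam x})

/-- The set `V` of vertices of `Δ`. -/
def vertices {n : ℕ} (lam : Fin n → ℕ) : Set (GCIndex n → ℝ) :=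
  (polytope lam).extremePoints ℝ

/-- The set `Π_λ` of lattice points of `Δ`. -/
abbrev LatticePoint {n : ℕ} (lam : Fin n → ℕ) : Type :=
  {x : GCIndex n → ℤ // toReal x ∈ polytope lam}

/-! ### Positive paths and the binomial variety `X_0` -/

/-- The sequences `I = [i_1 < ⋯ < i_m]` in `{1, …, n}` (shifted by one), i.e. the positive paths
`π_I` with `m` rightward steps, at the `i_1, …, i_m`-th steps, and `n - m` upward steps. -/
abbrev PosPath (m n : ℕ) : Type := Fin m ↪o Fin n

/-- `π_I ≤ π_J`: `J` is at most as long as `I` and `i_r ≤ j_r` for every `r ≤ |J|`. -/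
def PosPath.Below {l m n : ℕ} (I : PosPath l n) (J : PosPath m n) : Prop :=
  ∃ h : m ≤ l, ∀ r : Fin m, I (Fin.castLE h r) ≤ J r

/-- `I ∨ J = {max(i_1, j_1), …, max(i_m, j_m)}`. -/
def PosPath.join {l m n : ℕ} (h : m ≤ l) (I : PosPath l n) (J : PosPath m n) : PosPath m n :=
  OrderEmbedding.ofStrictMono (fun r => max (I (Fin.castLE h r)) (J r)) (by
    intro r s hrs
    have h1 : I (Fin.castLE h r) < I (Fin.castLE h s) := I.strictMono hrs
    have h2 : J r < J s := J.strictMono hrs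
    exact max_lt_max h1 h2)

/-- `I ∧ J = {min(i_1, j_1), …, min(i_m, j_m), i_{m+1}, …, i_l}`. -/
def PosPath.meet {l m n : ℕ} (I : PosPath l n) (J : PosPath m n) : PosPath l n :=
  OrderEmbedding.ofStrictMono
    (fun r => if h : (r : ℕ) < m then min (I r) (J ⟨r, h⟩) else I r) (by
    intro r s hrs
    have h1 : I r < I s := I.strictMono hrs
    by_cases hs : (s : ℕ) < m
    · have hr : (r : ℕ) < m := lt_trans hrs hs
      have h2 : J ⟨r, hr⟩ < J ⟨s, hs⟩ := J.strictMono hrs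
      simp only [hs, hr, dif_pos]
      exact min_lt_min h1 h2
    · by_cases hr : (r : ℕ) < m
      · simp only [hs, hr, dif_pos, dif_neg, not_false_iff]
        exact lt_of_le_of_lt (min_le_left _ _) h1
      · simpa only [hs, hr, dif_neg, not_false_iff] using h1)

/-- `∏ᵢ ℙ(⋀^{n_i} ℂⁿ)`, in homogeneous coordinates `p_I` indexed by the sequences `I` of
length `n_i`. -/
abbrev FlagType.Ambient {k n : ℕ} (D : FlagType k n) : Type :=
  ∀ i : Fin k, ℙ ℂ (PosPath (D.dim i) n → ℂ)

/-- `X_0`: the locus `p_I p_J = p_{I ∨ J} p_{I ∧ J}` for all incomparable pairs `(π_I, π_J)`.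
The equations are multihomogeneous, so the choice of representatives does not matter. -/
def FlagType.toricX {k n : ℕ} (D : FlagType k n) : Set D.Ambient :=
  {p | ∀ (i j : Fin k) (h : D.dim j ≤ D.dim i) (I : PosPath (D.dim i) n) (J : PosPath (D.dim j) n),
    ¬ I.Below J → ¬ J.Below I →
      (p i).rep I * (p j).rep J = (p j).rep (I.join h J) * (p i).rep (I.meet J)}

/-! ### The toric variety of `Δ` and its toric subvarieties -/

/-- Zariski closure in projective space. -/
def zariskiClosure {ι : Type} (S : Set (ℙ ℂ (ι → ℂ))) : Set (ℙ ℂ (ι → ℂ)) :=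
  {q | ∀ (d : ℕ) (P : MvPolynomial ι ℂ), P.IsHomogeneous d →
    (∀ s ∈ S, MvPolynomial.eval s.rep P = 0) → MvPolynomial.eval q.rep P = 0}

open Classical in
/-- The vector with coordinate `t^χ` at the lattice points `χ` of `F`, and `0` at the others. -/
def orbitVector {n : ℕ} (lam : Fin n → ℕ) (F : Set (GCIndex n → ℝ)) (t : GCIndex n → ℂˣ) :
    LatticePoint lam → ℂ :=
  fun χ => if toReal χ.1 ∈ F then ∏ p, ((t p : ℂ)) ^ (χ.1 p) else 0

/-- The toric subvariety `X_{Δ(F)}` of the projective toric variety `X_Δ ⊆ ℙ(ℂ^{Π_λ})` attached to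
a face `F` of `Δ`: the closure of the torus orbit of `F`.  For `F = Δ` it is `X_Δ` itself. -/
def toricSubvariety {n : ℕ} (lam : Fin n → ℕ) (F : Set (GCIndex n → ℝ)) :
    Set (ℙ ℂ (LatticePoint lam → ℂ)) :=
  zariskiClosure {q | ∃ (t : GCIndex n → ℂˣ) (h : orbitVector lam F t ≠ 0),
    q = Projectivization.mk ℂ (orbitVector lam F t) h}

/-- The exponent vector `β_I`: it is `1` at the boxes right above the path `π_I`, i.e. at the
positions `(i_r, r)`, and `0` elsewhere. -/
def beta {m n : ℕ} (I : PosPath m n) : GCIndex n → ℤ :=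
  fun p => if ∃ r : Fin m, (r : ℕ) = p.1.2 ∧ I r = p.1.1 then 1 else 0

/-- The bijection `φ : {b_{i,j}} ↦ {b_{j,j} + ⋯ + b_{i,j}}`. -/
def phi {n : ℕ} (b : GCIndex n → ℤ) : GCIndex n → ℤ :=
  fun p => ∑ q : GCIndex n with q.1.2 = p.1.2 ∧ q.1.1 ≤ p.1.1, b q

/-- `b_{n_i} = λ_{n_i} - λ_{n_i + 1}` for `1 ≤ i ≤ k`. -/
def FlagType.mult {k n : ℕ} (D : FlagType k n) (lam : Fin n → ℕ) (i : Fin k) : ℕ :=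
  lam ⟨D.dim i - 1, lt_of_le_of_lt (Nat.sub_le _ _) (D.dim_lt i)⟩ - lam ⟨D.dim i, D.dim_lt i⟩

/-- `b_n = λ_n`. -/
def lastMult {n : ℕ} (lam : Fin n → ℕ) : ℕ :=
  if h : 0 < n then lam ⟨n - 1, Nat.sub_lt h Nat.one_pos⟩ else 0

/-- The monomials `∏ p_I` with exactly `b_{n_i}` factors from the `i`-th projective space, which are
the coordinates of the projective embedding of `X_0` by `𝒪(b_{n_1}, …, b_{n_k})`.  The factor
`Sym^{b_n}(⋀ⁿ ℂⁿ)` is one-dimensional and only contributes to the weight. -/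
abbrev FlagType.Monomial {k n : ℕ} (D : FlagType k n) (lam : Fin n → ℕ) : Type :=
  ∀ i : Fin k, Fin (D.mult lam i) → PosPath (D.dim i) n

/-- The value of a monomial at (the chosen representatives of) a point. -/
def FlagType.monomialValue {k n : ℕ} (D : FlagType k n) (lam : Fin n → ℕ)
    (f : D.Monomial lam) (p : D.Ambient) : ℂ :=
  ∏ i, ∏ s, (p i).rep (f i s)

/-- The lattice point `φ(∑ β_I)` of a monomial; the sum includes `b_n` copies of
`β_{[1, 2, …, n]}`. -/
def FlagType.monomialPoint {k n : ℕ} (D : FlagType k n) (lam : Fin n → ℕ)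
    (f : D.Monomial lam) : GCIndex n → ℤ :=
  phi ((∑ i, ∑ s, beta (f i s)) + lastMult lam • beta (RelEmbedding.refl (· ≤ ·) : PosPath n n))

/-- The identification of `X_0` with `X_Δ` given by the two projective embeddings: `p` and `q`
correspond if, up to a common scalar, the coordinate of `q` at `χ ∈ Π_λ` is the value at `p` of
every monomial with lattice point `χ`. -/
def FlagType.Corresponds {k n : ℕ} (D : FlagType k n) (lam : Fin n → ℕ)
    (p : D.Ambient) (q : ℙ ℂ (LatticePoint lam → ℂ)) : Prop :=
  ∃ c : ℂ, c ≠ 0 ∧ ∀ (f : D.Monomial lam) (χ : LatticePoint lam),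
    D.monomialPoint lam f = χ.1 → q.rep χ = c * D.monomialValue lam f p

/-- The toric subvariety `X_0(F) ⊆ X_0 ⊆ ∏ᵢ ℙ(⋀^{n_i} ℂⁿ)` attached to a face `F` of `Δ`. -/
def FlagType.toricXFace {k n : ℕ} (D : FlagType k n) (lam : Fin n → ℕ)
    (F : Set (GCIndex n → ℝ)) : Set D.Ambient :=
  {p | p ∈ D.toricX ∧ ∃ q ∈ toricSubvariety lam F, D.Corresponds lam p q}

/-! ### The partial flag variety in its Plücker embedding -/

/-- The maximal minors of the matrix with rows `v_1, …, v_m`. -/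
def plucker {m n : ℕ} (v : Fin m → Fin n → ℂ) : PosPath m n → ℂ :=
  fun I => (Matrix.of fun r s : Fin m => v r (I s)).det

/-- `Pl(X)`, for `X = {V_1 ⊆ ⋯ ⊆ V_k ⊆ ℂⁿ | dim V_i = n_i}`. -/
def FlagType.flagVariety {k n : ℕ} (D : FlagType k n) : Set D.Ambient :=
  {p | ∃ W : Fin k → Submodule ℂ (Fin n → ℂ),
    Monotone W ∧ (∀ i, Module.finrank ℂ (W i) = D.dim i) ∧
    ∀ i, ∃ v : Fin (D.dim i) → Fin n → ℂ,
      LinearIndependent ℂ v ∧ Submodule.span ℂ (Set.range v) = W i ∧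
      ∃ h : plucker v ≠ 0, p i = Projectivization.mk ℂ (plucker v) h}

/-- `V^X`: the vertices `z` for which (the toric subvariety `X_0(z)` is a single point and) the
point `X_0(z)` lies in `X`. -/
def FlagType.verticesX {k n : ℕ} (D : FlagType k n) (lam : Fin n → ℕ) : Set (GCIndex n → ℝ) :=
  {z | z ∈ vertices lam ∧ ∃ p ∈ D.flagVariety, D.toricXFace lam {z} = {p}}

/-- A coordinate point of a projective space: exactly one homogeneous coordinate is nonzero. -/
def IsCoordinatePoint {ι : Type} (q : ℙ ℂ (ι → ℂ)) : Prop := ∃! a, q.rep a ≠ 0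

end GelfandCetlin

end

namespace GelfandCetlin

/-! The array `phi (beta I)` is the 0/1 array whose column `r` switches from 0 to 1 at row `i_r`.
Sums of such arrays (plus the constant `λ_n`) are Gelfand–Cetlin patterns, and slicing a pattern
into its level sets `{c < x}` shows that every pattern arises this way
(`IsGCPattern.exists_monomialPoint_eq`); the slices are the columns of a semistandard tableau.

Everything about vertices comes from an exchange argument. Trading factors between two monomials
over a vertex `z` gives two lattice points with midpoint `z`; extremality makes both equal to `z`,
and injectivity of `I ↦ phi (beta I)` makes the traded factors equal. Hence exactly one monomial
lies over `z`, a product of powers of one `p_{I_i}` for each `i` (`factor_eq_factor`). The orbit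
closure of `{z}` is a coordinate point of `ℙ(ℂ^{Π_λ})`, and the only point of `X_0` matching it is
the coordinate point at `(I_i)` (`corresponds_coordPoint_iff`).

For a Grassmannian the pattern of each `p_I ^ b` is a corner of a cube containing `Δ`, so every `I`
occurs; its coordinate point is a coordinate subspace, hence lies in `X`. -/

theorem PosPath.val_le {m n : ℕ} (I : PosPath m n) (r : Fin m) : (r : ℕ) ≤ I r := by
  obtain ⟨r, hr⟩ := r
  induction r with
  | zero => exact Nat.zero_le _
  | succ r ih =>
    have h1 := ih (by omega)
    have h2 : I ⟨r, by omega⟩ < I ⟨r + 1, hr⟩ := I.strictMono (by simp [Fin.lt_def])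
    have h3 := Fin.lt_def.mp h2
    simp only at h1 ⊢
    omega

/-! ### The arrays of single paths -/

theorem phi_beta {m n : ℕ} (I : PosPath m n) (p : GCIndex n) :
    phi (beta I) p =
      if h : (p.1.2 : ℕ) < m then (if I ⟨p.1.2, h⟩ ≤ p.1.1 then 1 else 0) else 0 := by
  unfold phi
  split_ifs with h h'
  · have hle : p.1.2 ≤ I ⟨p.1.2, h⟩ := Fin.le_def.mpr (I.val_le ⟨p.1.2, h⟩)
    rw [Finset.sum_eq_single (⟨(I ⟨p.1.2, h⟩, p.1.2), hle⟩ : GCIndex n)]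
    · exact if_pos ⟨⟨p.1.2, h⟩, rfl, rfl⟩
    · rintro ⟨⟨a, b⟩, hab⟩ hq hne
      simp only [Finset.mem_filter, Finset.mem_univ, true_and] at hq
      refine if_neg ?_
      rintro ⟨r, hr1, hr2⟩
      apply hne
      simp only at hr1 hr2 hq
      have : r = ⟨p.1.2, h⟩ := Fin.ext (by rw [hr1, hq.1])
      subst this
      simp [hr2, hq.1]
    · intro hq
      exact absurd (Finset.mem_filter.mpr ⟨Finset.mem_univ _, rfl, h'⟩) hq
  · refine Finset.sum_eq_zero fun q hq => if_neg ?_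
    simp only [Finset.mem_filter, Finset.mem_univ, true_and] at hq
    rintro ⟨r, hr1, hr2⟩
    have : r = ⟨p.1.2, h⟩ := Fin.ext (by rw [hr1, hq.1])
    subst this
    exact h' (hr2 ▸ hq.2)
  · refine Finset.sum_eq_zero fun q hq => if_neg ?_
    simp only [Finset.mem_filter, Finset.mem_univ, true_and] at hq
    rintro ⟨r, hr1, hr2⟩
    exact h (by rw [← hq.1, ← hr1]; exact r.2)

theorem phi_beta_injective {m n : ℕ} {I J : PosPath m n} (h : phi (beta I) = phi (beta J)) :
    I = J := by
  have key : ∀ {I J : PosPath m n}, phi (beta I) = phi (beta J) → ∀ r, J r ≤ I r := by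
    intro I J h r
    have hr := congrFun h ⟨(I r, ⟨r, lt_of_le_of_lt (I.val_le r) (I r).2⟩), Fin.le_def.mpr (I.val_le r)⟩
    rw [phi_beta, phi_beta] at hr
    by_contra hlt
    simp [hlt] at hr
  ext r
  exact congrArg _ (le_antisymm (key h.symm r) (key h r))

theorem PosPath.meet_apply {l m n : ℕ} (I : PosPath l n) (J : PosPath m n) (r : Fin l) :
    I.meet J r = if h : (r : ℕ) < m then min (I r) (J ⟨r, h⟩) else I r := rfl

/-- In each column the switching rows `i_r`, `j_r` are merely replaced by their minimum and maximum.
This makes the binomial equations homogeneous for the lattice point grading. -/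
theorem phi_beta_join_add_meet {l m n : ℕ} (h : m ≤ l) (I : PosPath l n) (J : PosPath m n) :
    phi (beta (I.meet J)) + phi (beta (I.join h J)) = phi (beta I) + phi (beta J) := by
  funext p
  simp only [Pi.add_apply, phi_beta]
  by_cases h1 : (p.1.2 : ℕ) < m
  · have h2 := lt_of_lt_of_le h1 h
    have hm : I.meet J ⟨p.1.2, h2⟩ = min (I ⟨p.1.2, h2⟩) (J ⟨p.1.2, h1⟩) := by
      rw [PosPath.meet_apply, dif_pos h1]
    have hj : I.join h J ⟨p.1.2, h1⟩ = max (I ⟨p.1.2, h2⟩) (J ⟨p.1.2, h1⟩) := rfl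
    simp only [h1, h2, dif_pos, hm, hj]
    rcases le_total (I ⟨p.1.2, h2⟩) (J ⟨p.1.2, h1⟩) with hle | hle
    · simp only [min_eq_left hle, max_eq_right hle]
    · simp only [min_eq_right hle, max_eq_left hle, add_comm]
  · by_cases h2 : (p.1.2 : ℕ) < l
    · have hm : I.meet J ⟨p.1.2, h2⟩ = I ⟨p.1.2, h2⟩ := by
        rw [PosPath.meet_apply, dif_neg h1]
      simp only [h1, h2, dif_pos, dif_neg, not_false_iff, hm]
    · simp only [h1, h2, dif_neg, not_false_iff]

theorem phi_beta_refl {n : ℕ} (p : GCIndex n) :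
    phi (beta (RelEmbedding.refl (· ≤ ·) : PosPath n n)) p = 1 := by
  rw [phi_beta, dif_pos p.1.2.2, if_pos]
  exact p.2

theorem phi_beta_le_above {m n : ℕ} (I : PosPath m n) (p q : GCIndex n)
    (h1 : (q.1.1 : ℕ) = p.1.1 + 1) (h2 : q.1.2 = p.1.2) : phi (beta I) p ≤ phi (beta I) q := by
  rw [phi_beta, phi_beta]
  by_cases h : (p.1.2 : ℕ) < m
  · have hq : (q.1.2 : ℕ) < m := h2 ▸ h
    have e : (⟨q.1.2, hq⟩ : Fin m) = ⟨p.1.2, h⟩ := Fin.ext (congrArg (fun j : Fin n => (j : ℕ)) h2)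
    rw [dif_pos h, dif_pos hq, e]
    by_cases h3 : I ⟨p.1.2, h⟩ ≤ p.1.1
    · rw [if_pos h3, if_pos (h3.trans (Fin.le_def.mpr (by omega)))]
    · rw [if_neg h3]; split_ifs <;> norm_num
  · rw [dif_neg h]; split_ifs <;> norm_num

/-- Since `i_r < i_{r+1}`, a switch in column `r + 1` by row `a + 1` forces one in column `r` by row
`a`. -/
theorem phi_beta_right_le {m n : ℕ} (I : PosPath m n) (p q : GCIndex n)
    (h1 : (q.1.1 : ℕ) = p.1.1 + 1) (h2 : (q.1.2 : ℕ) = p.1.2 + 1) :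
    phi (beta I) q ≤ phi (beta I) p := by
  rw [phi_beta, phi_beta]
  by_cases hq : (q.1.2 : ℕ) < m
  · have h : (p.1.2 : ℕ) < m := by omega
    rw [dif_pos h, dif_pos hq]
    by_cases h3 : I ⟨q.1.2, hq⟩ ≤ q.1.1
    · have hlt : I ⟨p.1.2, h⟩ < I ⟨q.1.2, hq⟩ := I.strictMono (Fin.lt_def.mpr (by simp; omega))
      rw [if_pos h3, if_pos]
      rw [Fin.le_def] at h3 ⊢
      rw [Fin.lt_def] at hlt
      omega
    · rw [if_neg h3]; split_ifs <;> norm_num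
  · rw [dif_neg hq]; split_ifs <;> norm_num

/-! ### Lattice points of monomials are patterns -/

theorem phi_add {n : ℕ} (a b : GCIndex n → ℤ) : phi (a + b) = phi a + phi b := by
  funext p
  simp [phi, Finset.sum_add_distrib]

/-- The bijection `phi` as a homomorphism of groups. -/
noncomputable def phiHom (n : ℕ) : (GCIndex n → ℤ) →+ (GCIndex n → ℤ) :=
  AddMonoidHom.mk' phi phi_add

theorem monomialPoint_eq {k n : ℕ} (D : FlagType k n) (lam : Fin n → ℕ) (f : D.Monomial lam) :
    D.monomialPoint lam f = (∑ i, ∑ s, phi (beta (f i s))) + fun _ => (lastMult lam : ℤ) := by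
  have h : ∀ a, phi a = phiHom n a := fun _ => rfl
  unfold FlagType.monomialPoint
  rw [h, map_add, map_sum, map_nsmul]
  congr 1
  · refine Finset.sum_congr rfl fun i _ => ?_
    rw [map_sum]
    rfl
  · funext p
    rw [← h, Pi.smul_apply, phi_beta_refl]
    simp

theorem monomialPoint_apply {k n : ℕ} (D : FlagType k n) (lam : Fin n → ℕ) (f : D.Monomial lam)
    (p : GCIndex n) :
    D.monomialPoint lam f p = (∑ i, ∑ s, phi (beta (f i s)) p) + (lastMult lam : ℤ) := by
  rw [monomialPoint_eq]
  simp [Finset.sum_apply]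

theorem lastMult_eq {n : ℕ} (lam : Fin n → ℕ) (j : Fin n) (hj : (j : ℕ) + 1 = n) :
    lastMult lam = lam j := by
  unfold lastMult
  rw [dif_pos (by omega)]
  congr 1
  ext
  simp
  omega

theorem lam_dim_sub_one {k n : ℕ} {D : FlagType k n} {lam : Fin n → ℕ} (hD : D.IsWeight lam)
    (i : Fin k) : lam ⟨D.dim i, D.dim_lt i⟩ <
      lam ⟨D.dim i - 1, lt_of_le_of_lt (Nat.sub_le _ _) (D.dim_lt i)⟩ := by
  have h0 := D.dim_pos i
  have h1 := D.dim_lt i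
  have := (hD.drop_iff (D.dim i - 1) (by omega)).mpr ⟨i, by omega⟩
  convert this using 3
  omega

theorem mult_pos {k n : ℕ} {D : FlagType k n} {lam : Fin n → ℕ} (hD : D.IsWeight lam)
    (i : Fin k) : 0 < D.mult lam i :=
  Nat.sub_pos_of_lt (lam_dim_sub_one hD i)

/-- Both sides count the integers `c` with `a ≤ c < b` and `c < y`. -/
theorem sum_fin_indicator (a b : ℕ) (y : ℤ) (ha : (a : ℤ) ≤ b) :
    (∑ s : Fin (b - a), if ((a : ℤ) + (s : ℕ) < y) then (1 : ℤ) else 0) = min y b - min y a := by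
  obtain ⟨d, rfl⟩ := Nat.exists_eq_add_of_le (Int.ofNat_le.mp ha)
  rw [Nat.add_sub_cancel_left, Fin.sum_univ_eq_sum_range (fun s => if ((a : ℤ) + s < y) then (1 : ℤ) else 0)]
  clear ha
  induction d with
  | zero => simp
  | succ d ih =>
    rw [Finset.sum_range_succ, ih]
    push_cast
    split_ifs <;> omega

/-- The intervals `[λ_{n_i + 1}, λ_{n_i})` tile `[λ_n, λ_1)`, because `λ` is constant between its
drops. The sum therefore counts the integers in `[λ_n, y)`. -/
theorem sum_indicator_add_lastMult {k n : ℕ} {D : FlagType k n} {lam : Fin n → ℕ}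
    (hD : D.IsWeight lam) (hn : 0 < n) (y : ℤ) (h1 : (lastMult lam : ℤ) ≤ y)
    (h2 : y ≤ lam ⟨0, hn⟩) :
    (∑ i, ∑ s : Fin (D.mult lam i),
      if ((lam ⟨D.dim i, D.dim_lt i⟩ : ℤ) + (s : ℕ) < y) then (1 : ℤ) else 0) + lastMult lam = y := by
  set u : ℕ → ℤ := fun j => min y (if h : j < n then (lam ⟨j, h⟩ : ℤ) else 0) with hu
  have e1 : ∀ i : Fin k, (∑ s : Fin (D.mult lam i),
      if ((lam ⟨D.dim i, D.dim_lt i⟩ : ℤ) + (s : ℕ) < y) then (1 : ℤ) else 0) =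
        u (D.dim i - 1) - u (D.dim i - 1 + 1) := by
    intro i
    have h3 := D.dim_lt i
    have h4 := D.dim_pos i
    have e : D.dim i - 1 + 1 = D.dim i := by omega
    rw [e]
    simp only [hu]
    rw [dif_pos h3, dif_pos (by omega)]
    exact sum_fin_indicator _ _ y (by exact_mod_cast (lam_dim_sub_one hD i).le)
  rw [Finset.sum_congr rfl fun i _ => e1 i]
  -- Inserting the positions without a drop adds only zero terms, and the sum then telescopes.
  have e2 : ∑ i, (u (D.dim i - 1) - u (D.dim i - 1 + 1)) =
      ∑ m ∈ Finset.range (n - 1), (u m - u (m + 1)) := by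
    refine Finset.sum_of_injOn (fun i => D.dim i - 1) ?_ ?_ ?_ ?_
    · intro i _ j _ hij
      have h3 := D.dim_pos i
      have h4 := D.dim_pos j
      simp only at hij
      exact D.dim_strictMono.injective (by omega)
    · intro i _
      have h3 := D.dim_lt i
      have h4 := D.dim_pos i
      simp
      omega
    · intro m hm hm'
      rw [Finset.mem_range] at hm
      have hle := hD.antitone (a := ⟨m, by omega⟩) (b := ⟨m + 1, by omega⟩) (by simp [Fin.le_def])
      have hnd : ¬ lam ⟨m + 1, by omega⟩ < lam ⟨m, by omega⟩ := by
        rw [hD.drop_iff m (by omega)]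
        rintro ⟨i, hi⟩
        exact hm' ⟨i, by simp, by simp [hi]⟩
      simp only [hu]
      rw [dif_pos (by omega), dif_pos (by omega), le_antisymm hle (not_lt.mp hnd), sub_self]
    · intros; rfl
  rw [e2, Finset.sum_range_sub' u]
  simp only [hu]
  rw [dif_pos hn, dif_pos (by omega), ← lastMult_eq lam ⟨n - 1, by omega⟩ (by simp; omega)]
  omega

theorem monomialPoint_isGCPattern {k n : ℕ} {D : FlagType k n} {lam : Fin n → ℕ}
    (hD : D.IsWeight lam) (f : D.Monomial lam) : IsGCPattern lam (D.monomialPoint lam f) where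
  top := by
    intro p hp
    have hn : 0 < n := by omega
    rw [monomialPoint_apply]
    have h2 : lam p.1.2 ≤ lam ⟨0, hn⟩ := hD.antitone (Fin.le_def.mpr (Nat.zero_le _))
    have h3 : lastMult lam ≤ lam p.1.2 := by
      rw [lastMult_eq lam p.1.1 hp]
      exact hD.antitone p.2
    -- With `λ_j` written as a count, the terms agree one by one: in the last row every switch has
    -- occurred, so both indicators only test `j ≤ n_i`.
    rw [← sum_indicator_add_lastMult hD hn (lam p.1.2) (by exact_mod_cast h3) (by exact_mod_cast h2)]
    congr 1
    refine Finset.sum_congr rfl fun i _ => Finset.sum_congr rfl fun s _ => ?_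
    rw [phi_beta]
    by_cases h : (p.1.2 : ℕ) < D.dim i
    · have hle : f i s ⟨p.1.2, h⟩ ≤ p.1.1 := Fin.le_def.mpr (by omega)
      rw [dif_pos h, if_pos hle, if_pos]
      have h4 : lam ⟨D.dim i - 1, lt_of_le_of_lt (Nat.sub_le _ _) (D.dim_lt i)⟩ ≤ lam p.1.2 :=
        hD.antitone (Fin.le_def.mpr (by simp only; omega))
      have h5 := s.2
      simp only [FlagType.mult] at h5
      omega
    · rw [dif_neg h, if_neg]
      have h4 : lam p.1.2 ≤ lam ⟨D.dim i, D.dim_lt i⟩ :=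
        hD.antitone (Fin.le_def.mpr (by simp only; omega))
      omega
  le_above := by
    intro p q h1 h2
    rw [monomialPoint_apply, monomialPoint_apply]
    gcongr with i _ s _
    exact phi_beta_le_above _ p q h1 h2
  right_le := by
    intro p q h1 h2
    rw [monomialPoint_apply, monomialPoint_apply]
    gcongr with i _ s _
    exact phi_beta_right_le _ p q h1 h2

/-! ### Every pattern is the lattice point of a monomial -/

namespace IsGCPattern

variable {n : ℕ} {lam : Fin n → ℕ} {x : GCIndex n → ℤ}

theorem le_of_row_le (hx : IsGCPattern lam x) (p q : GCIndex n) (h1 : p.1.1 ≤ q.1.1)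
    (h2 : q.1.2 = p.1.2) : x p ≤ x q := by
  obtain ⟨d, hd⟩ := Nat.exists_eq_add_of_le (Fin.le_def.mp h1)
  induction d generalizing q with
  | zero =>
    have : p = q := Subtype.ext (Prod.ext (Fin.ext (by omega)) h2.symm)
    rw [this]
  | succ d ih =>
    have hp := Fin.le_def.mp p.2
    have hq := q.1.1.2
    have h3 : (⟨p.1.1 + d, by omega⟩ : Fin n) ≥ q.1.2 := by
      rw [h2]; exact Fin.le_def.mpr (by simp only; omega)
    refine (ih ⟨(⟨p.1.1 + d, by omega⟩, q.1.2), h3⟩ (Fin.le_def.mpr (by simp)) h2 rfl).trans ?_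
    exact hx.le_above _ _ (by simp only; omega) rfl

theorem le_of_diagonal (hx : IsGCPattern lam x) (p q : GCIndex n) (d : ℕ)
    (h1 : (q.1.1 : ℕ) = p.1.1 + d) (h2 : (q.1.2 : ℕ) = p.1.2 + d) : x q ≤ x p := by
  induction d generalizing q with
  | zero =>
    have : p = q := Subtype.ext (Prod.ext (Fin.ext (by omega)) (Fin.ext (by omega)))
    rw [this]
  | succ d ih =>
    have hp := Fin.le_def.mp p.2
    have hq := q.1.1.2
    refine le_trans ?_ (ih ⟨(⟨p.1.1 + d, by omega⟩, ⟨p.1.2 + d, by omega⟩),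
      Fin.le_def.mpr (by simp only; omega)⟩ rfl rfl)
    exact hx.right_le _ _ (by simp only; omega) (by simp only; omega)

theorem le_lam (hx : IsGCPattern lam x) (p : GCIndex n) : x p ≤ lam p.1.2 := by
  have h1 := p.1.1.2
  have h : p.1.1 ≤ (⟨n - 1, by omega⟩ : Fin n) := Fin.le_def.mpr (by simp only; omega)
  rw [← hx.top ⟨(⟨n - 1, by omega⟩, p.1.2), p.2.trans h⟩ (by simp only; omega)]
  exact hx.le_of_row_le _ _ h rfl

theorem lastMult_le (hx : IsGCPattern lam x) (hl : Antitone lam) (p : GCIndex n) :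
    (lastMult lam : ℤ) ≤ x p := by
  have h1 := p.1.1.2
  have h2 := Fin.le_def.mp p.2
  have h3 := hx.le_of_diagonal p ⟨(⟨n - 1, by omega⟩, ⟨p.1.2 + (n - 1 - p.1.1), by omega⟩),
    Fin.le_def.mpr (by simp only; omega)⟩ (n - 1 - p.1.1) (by simp only; omega) rfl
  rw [hx.top _ (by simp only; omega)] at h3
  refine le_trans ?_ h3
  rw [lastMult_eq lam ⟨n - 1, by omega⟩ (by simp only; omega)]
  exact_mod_cast hl (Fin.le_def.mpr (by simp only; omega))

/-- The column of the semistandard tableau of a pattern that lies right of the `c`-th one. -/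
theorem exists_column (hx : IsGCPattern lam x) (hl : Antitone lam) (m : ℕ) (hm : m < n) (c : ℤ)
    (h1 : ∀ j : Fin n, (j : ℕ) < m → c < lam j) (h2 : (lam ⟨m, hm⟩ : ℤ) ≤ c) :
    ∃ I : PosPath m n, ∀ p, phi (beta I) p = if c < x p then 1 else 0 := by
  have key : ∀ r : Fin m, ∃ a : Fin n, ∃ h : (⟨r, by omega⟩ : Fin n) ≤ a,
      c < x ⟨(a, ⟨r, by omega⟩), h⟩ ∧
        ∀ p : GCIndex n, (p.1.2 : ℕ) = r → c < x p → a ≤ p.1.1 := by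
    intro r
    have hr := r.2
    -- The entry `i_r` is the first row of column `r` at which the pattern exceeds `c`.
    let S : Set (Fin n) := {a | ∃ h : (⟨r, by omega⟩ : Fin n) ≤ a, c < x ⟨(a, ⟨r, by omega⟩), h⟩}
    have hS : S.Nonempty := by
      refine ⟨⟨n - 1, by omega⟩, Fin.le_def.mpr (by simp only; omega), ?_⟩
      rw [hx.top _ (by simp only; omega)]
      exact h1 _ hr
    obtain ⟨h, ha⟩ := wellFounded_lt.min_mem S hS
    refine ⟨wellFounded_lt.min S hS, h, ha, fun p hp hc => ?_⟩
    have hp' : (⟨r, by omega⟩ : Fin n) = p.1.2 := Fin.ext hp.symm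
    have hS' : p.1.1 ∈ S := by
      simp only [S, hp']
      exact ⟨p.2, hc⟩
    exact WellFounded.min_le wellFounded_lt hS'
  choose a hle ha hmin using key
  have hmono : StrictMono a := by
    intro r s hrs
    rw [Fin.lt_def] at hrs
    have h3 := Fin.le_def.mp (hle s)
    have h4 := (a s).2
    simp only at h3
    -- Going back `s - r` steps along the diagonal from `(a s, s)` reaches column `r` without
    -- decreasing the entry, so `a r ≤ a s - (s - r)`.
    let q : GCIndex n := ⟨(⟨a s - (s - r), by omega⟩, ⟨r, by omega⟩),
      Fin.le_def.mpr (by simp only; omega)⟩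
    have h5 := hx.le_of_diagonal q ⟨(a s, ⟨s, by omega⟩), hle s⟩ (s - r)
      (by simp only [q]; omega) (by simp only [q]; omega)
    have h6 := Fin.le_def.mp (hmin r q rfl (lt_of_lt_of_le (ha s) h5))
    simp only [q] at h6
    rw [Fin.lt_def]
    omega
  refine ⟨OrderEmbedding.ofStrictMono a hmono, fun p => ?_⟩
  rw [phi_beta]
  by_cases h : (p.1.2 : ℕ) < m
  · rw [dif_pos h]
    refine if_congr ⟨fun hp => ?_, fun hp => hmin ⟨p.1.2, h⟩ p rfl hp⟩ rfl rfl
    exact lt_of_lt_of_le (ha ⟨p.1.2, h⟩) (hx.le_of_row_le _ p hp rfl)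
  · rw [dif_neg h, if_neg]
    have h3 := hx.le_lam p
    have h4 : lam p.1.2 ≤ lam ⟨m, hm⟩ := hl (Fin.le_def.mpr (by simp only; omega))
    omega

/-- Layer-cake decomposition: a level `c` in `[λ_{n_i + 1}, λ_{n_i})` yields a path with `n_i`
entries, and counting the levels below `x p` recovers `x p`. -/
theorem exists_monomialPoint_eq {k : ℕ} {D : FlagType k n} (hD : D.IsWeight lam)
    (hx : IsGCPattern lam x) : ∃ f : D.Monomial lam, D.monomialPoint lam f = x := by
  have key : ∀ (i : Fin k) (s : Fin (D.mult lam i)), ∃ I : PosPath (D.dim i) n,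
      ∀ p, phi (beta I) p = if (lam ⟨D.dim i, D.dim_lt i⟩ : ℤ) + (s : ℕ) < x p then 1 else 0 := by
    intro i s
    refine hx.exists_column hD.antitone _ (D.dim_lt i) _ (fun j hj => ?_) (by omega)
    have h4 : lam ⟨D.dim i - 1, lt_of_le_of_lt (Nat.sub_le _ _) (D.dim_lt i)⟩ ≤ lam j :=
      hD.antitone (Fin.le_def.mpr (by simp only; omega))
    have h5 := s.2
    simp only [FlagType.mult] at h5
    omega
  choose f hf using key
  refine ⟨f, funext fun p => ?_⟩
  have hn : 0 < n := by have := p.1.1.2; omega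
  rw [monomialPoint_apply]
  simp only [hf]
  refine sum_indicator_add_lastMult hD hn _ (hx.lastMult_le hD.antitone p) ((hx.le_lam p).trans ?_)
  exact_mod_cast hD.antitone (Fin.le_def.mpr (Nat.zero_le _))

end IsGCPattern

/-! ### Coordinate points and the orbit closure of a vertex -/

open Classical in
/-- The coordinate point whose only nonzero coordinate is the one at `a`. -/
noncomputable def coordPoint {ι : Type} (a : ι) : ℙ ℂ (ι → ℂ) :=
  Projectivization.mk ℂ (Pi.single a (1 : ℂ)) (Pi.single_ne_zero_iff.mpr one_ne_zero)

theorem coordPoint_rep_ne_zero_iff {ι : Type} {a b : ι} : (coordPoint a).rep b ≠ 0 ↔ b = a := by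
  classical
  obtain ⟨c, hc⟩ := Projectivization.exists_smul_eq_mk_rep ℂ (Pi.single a (1 : ℂ) : ι → ℂ)
    (Pi.single_ne_zero_iff.mpr one_ne_zero)
  have : (coordPoint a).rep = c • (Pi.single a (1 : ℂ) : ι → ℂ) := by
    rw [hc]
    unfold coordPoint
    congr!
  rw [this]
  by_cases h : b = a
  · subst h; simp [Units.smul_def]
  · simp [h]

theorem mk_eq_coordPoint {ι : Type} {a : ι} (v : ι → ℂ) (hv : v ≠ 0)
    (h : ∀ b, b ≠ a → v b = 0) : Projectivization.mk ℂ v hv = coordPoint a := by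
  classical
  refine (Projectivization.mk_eq_mk_iff' ℂ _ _ _ _).mpr ⟨v a, ?_⟩
  funext b
  by_cases hb : b = a
  · subst hb; simp
  · simp [hb, h b hb]

theorem eq_coordPoint {ι : Type} {a : ι} (q : ℙ ℂ (ι → ℂ)) (h : ∀ b, b ≠ a → q.rep b = 0) :
    q = coordPoint a := by
  rw [← mk_eq_coordPoint q.rep q.rep_nonzero h, Projectivization.mk_rep]

theorem isCoordinatePoint_iff {ι : Type} (q : ℙ ℂ (ι → ℂ)) :
    IsCoordinatePoint q ↔ ∃ a, q = coordPoint a := by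
  constructor
  · rintro ⟨a, _, h⟩
    exact ⟨a, eq_coordPoint q fun b hb => by_contra fun h' => hb (h b h')⟩
  · rintro ⟨a, rfl⟩
    exact ⟨a, coordPoint_rep_ne_zero_iff.mpr rfl, fun b hb => coordPoint_rep_ne_zero_iff.mp hb⟩

theorem toReal_injective {n : ℕ} : Function.Injective (toReal (n := n)) := by
  intro x y h
  funext p
  have := congrFun h p
  exact_mod_cast (show (x p : ℝ) = y p from this)

theorem toricSubvariety_singleton {n : ℕ} (lam : Fin n → ℕ) (χ : LatticePoint lam) :
    toricSubvariety lam {toReal χ.1} = {coordPoint χ} := by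
  have horbit : ∀ (t : GCIndex n → ℂˣ) (h : orbitVector lam {toReal χ.1} t ≠ 0),
      Projectivization.mk ℂ (orbitVector lam {toReal χ.1} t) h = coordPoint χ := by
    refine fun t h => mk_eq_coordPoint _ h fun ψ hψ => if_neg fun hmem => hψ ?_
    exact Subtype.ext (toReal_injective hmem)
  ext q
  rw [Set.mem_singleton_iff]
  constructor
  · intro hq
    refine eq_coordPoint q fun ψ hψ => ?_
    -- The linear forms `X ψ` with `ψ ≠ χ` already cut out the coordinate point.
    have := hq 1 (MvPolynomial.X ψ) (MvPolynomial.isHomogeneous_X _ _) ?_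
    · simpa using this
    · rintro s ⟨t, h, rfl⟩
      rw [MvPolynomial.eval_X, horbit]
      exact by_contra fun h' => hψ (coordPoint_rep_ne_zero_iff.mp h')
  · rintro rfl d P _ hP
    have hne : orbitVector lam {toReal χ.1} 1 ≠ 0 := by
      intro h
      have := congrFun h χ
      simp [orbitVector] at this
    exact hP _ ⟨1, hne, (horbit 1 hne).symm⟩

/-! ### Exchange argument at a vertex -/

theorem mem_polytope {n : ℕ} {lam : Fin n → ℕ} {x : GCIndex n → ℤ} (hx : IsGCPattern lam x) :
    toReal x ∈ polytope lam :=
  subset_convexHull ℝ _ ⟨x, hx, rfl⟩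

theorem eq_of_add_eq_two_nsmul {n : ℕ} {lam : Fin n → ℕ} {x y z : GCIndex n → ℤ}
    (hx : IsGCPattern lam x) (hy : IsGCPattern lam y) (hz : toReal z ∈ vertices lam)
    (h : x + y = z + z) : x = z := by
  refine toReal_injective (hz.2 (mem_polytope hx) (mem_polytope hy) ?_)
  refine ⟨1 / 2, 1 / 2, by norm_num, by norm_num, by norm_num, ?_⟩
  funext p
  have hp := congrFun h p
  simp only [Pi.add_apply] at hp
  have hp' : (x p : ℝ) + y p = z p + z p := by exact_mod_cast hp
  simp only [toReal, Pi.add_apply, Pi.smul_apply, smul_eq_mul]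
  linarith

section Vertex

variable {k n : ℕ} {D : FlagType k n} {lam : Fin n → ℕ}

/-- The monomial obtained by replacing one factor. -/
def replaceFactor (f : D.Monomial lam) (i : Fin k) (s : Fin (D.mult lam i))
    (J : PosPath (D.dim i) n) : D.Monomial lam :=
  Function.update f i (Function.update (f i) s J)

theorem replaceFactor_cases (f : D.Monomial lam) (i : Fin k) (s : Fin (D.mult lam i))
    (J : PosPath (D.dim i) n) (P : ∀ j, PosPath (D.dim j) n → Prop) (hJ : P i J)
    (hf : ∀ j t, P j (f j t)) (j : Fin k) (t : Fin (D.mult lam j)) :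
    P j (replaceFactor f i s J j t) := by
  unfold replaceFactor
  by_cases h : j = i
  · subst h
    rw [Function.update_self]
    by_cases h' : t = s
    · subst h'
      rwa [Function.update_self]
    · rw [Function.update_of_ne h']
      exact hf _ _
  · rw [Function.update_of_ne h]
    exact hf _ _

theorem monomialPoint_replaceFactor (f : D.Monomial lam) (i : Fin k) (s : Fin (D.mult lam i))
    (J : PosPath (D.dim i) n) :
    D.monomialPoint lam (replaceFactor f i s J) + phi (beta (f i s)) =
      D.monomialPoint lam f + phi (beta J) := by
  rw [monomialPoint_eq, monomialPoint_eq]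
  have h1 : ∀ g : D.Monomial lam, ∑ j, ∑ t, phi (beta (g j t)) =
      ∑ t, phi (beta (g i t)) + ∑ j ∈ Finset.univ.erase i, ∑ t, phi (beta (g j t)) := fun g =>
    (Finset.add_sum_erase _ _ (Finset.mem_univ i)).symm
  have h2 : ∀ g : D.Monomial lam, ∑ t, phi (beta (g i t)) =
      phi (beta (g i s)) + ∑ t ∈ Finset.univ.erase s, phi (beta (g i t)) := fun g =>
    (Finset.add_sum_erase _ _ (Finset.mem_univ s)).symm
  have h3 : ∑ j ∈ Finset.univ.erase i, ∑ t, phi (beta (replaceFactor f i s J j t)) =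
      ∑ j ∈ Finset.univ.erase i, ∑ t, phi (beta (f j t)) := by
    refine Finset.sum_congr rfl fun j hj => ?_
    simp only [replaceFactor, Function.update_of_ne (Finset.ne_of_mem_erase hj)]
  have h4 : ∑ t ∈ Finset.univ.erase s, phi (beta (replaceFactor f i s J i t)) =
      ∑ t ∈ Finset.univ.erase s, phi (beta (f i t)) := by
    refine Finset.sum_congr rfl fun t ht => ?_
    simp only [replaceFactor, Function.update_self,
      Function.update_of_ne (Finset.ne_of_mem_erase ht)]
  have h5 : replaceFactor f i s J i s = J := by simp [replaceFactor]
  rw [h1, h1 f, h3, h2, h2 f, h4, h5]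
  abel

/-- The monomial with the lattice point of a vertex is a product of powers, and it is unique. -/
theorem factor_eq_factor (hD : D.IsWeight lam) {f g : D.Monomial lam}
    (hf : toReal (D.monomialPoint lam f) ∈ vertices lam)
    (hfg : D.monomialPoint lam f = D.monomialPoint lam g) (i : Fin k) (s t : Fin (D.mult lam i)) :
    f i s = g i t := by
  have h1 := monomialPoint_replaceFactor f i s (g i t)
  have h2 := monomialPoint_replaceFactor g i t (f i s)
  -- Swapping `f i s` with `g i t` preserves the sum of the two lattice points, so the vertex is the
  -- midpoint of the new ones.
  have h3 : D.monomialPoint lam (replaceFactor f i s (g i t)) = D.monomialPoint lam f := by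
    refine eq_of_add_eq_two_nsmul (monomialPoint_isGCPattern hD _)
      (monomialPoint_isGCPattern hD (replaceFactor g i t (f i s))) hf ?_
    have h4 : _ + _ = _ + _ := congrArg₂ (· + ·) h1 h2
    rw [add_add_add_comm, add_add_add_comm (D.monomialPoint lam f),
      add_comm (phi (beta (g i t))), ← hfg] at h4
    exact add_right_cancel h4
  rw [h3] at h1
  exact phi_beta_injective (add_left_cancel h1)

/-- At a vertex, a pair of factors cannot be exchanged for another pair of the same weight. -/
theorem eq_factors_of_phi_beta_add_eq (hD : D.IsWeight lam) {f : D.Monomial lam}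
    (hf : toReal (D.monomialPoint lam f) ∈ vertices lam) {i j : Fin k} {s : Fin (D.mult lam i)}
    {t : Fin (D.mult lam j)} {I : PosPath (D.dim i) n} {J : PosPath (D.dim j) n}
    (h : phi (beta I) + phi (beta J) = phi (beta (f i s)) + phi (beta (f j t))) :
    I = f i s ∧ J = f j t := by
  -- The two replacements are made in separate copies of `f`, so the case of equal positions needs
  -- no special treatment.
  have h1 := monomialPoint_replaceFactor f i s I
  have h2 := monomialPoint_replaceFactor f j t J
  have h3 : D.monomialPoint lam (replaceFactor f i s I) = D.monomialPoint lam f := by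
    refine eq_of_add_eq_two_nsmul (monomialPoint_isGCPattern hD _)
      (monomialPoint_isGCPattern hD (replaceFactor f j t J)) hf ?_
    have h4 : _ + _ = _ + _ := congrArg₂ (· + ·) h1 h2
    rw [add_add_add_comm, add_add_add_comm (D.monomialPoint lam f), h] at h4
    exact add_right_cancel h4
  rw [h3] at h1
  have h5 := add_left_cancel h1
  rw [← h5] at h
  exact ⟨phi_beta_injective h5.symm, phi_beta_injective (add_left_cancel h)⟩

theorem exists_monomialPoint_of_mem_vertices (hD : D.IsWeight lam) {z : GCIndex n → ℝ}
    (hz : z ∈ vertices lam) :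
    ∃ I : ∀ i, PosPath (D.dim i) n, z = toReal (D.monomialPoint lam fun i _ => I i) := by
  obtain ⟨x, hx, rfl⟩ := extremePoints_convexHull_subset hz
  obtain ⟨f, rfl⟩ := IsGCPattern.exists_monomialPoint_eq hD hx
  refine ⟨fun i => f i ⟨0, mult_pos hD i⟩, ?_⟩
  congr
  funext i s
  exact factor_eq_factor hD hz rfl i _ _

theorem monomialValue_ne_zero_iff (f : D.Monomial lam) (p : D.Ambient) :
    D.monomialValue lam f p ≠ 0 ↔ ∀ i s, (p i).rep (f i s) ≠ 0 := by
  simp [FlagType.monomialValue, Finset.prod_ne_zero_iff]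

theorem coordPoint_mem_toricX (hD : D.IsWeight lam) {I : ∀ i, PosPath (D.dim i) n}
    (hz : toReal (D.monomialPoint lam fun i _ => I i) ∈ vertices lam) :
    (fun i => coordPoint (I i)) ∈ D.toricX := by
  have key : ∀ (i j : Fin k) (A : PosPath (D.dim i) n) (B : PosPath (D.dim j) n),
      phi (beta A) + phi (beta B) = phi (beta (I i)) + phi (beta (I j)) → A = I i ∧ B = I j := by
    intro i j A B h
    exact eq_factors_of_phi_beta_add_eq hD hz (i := i) (j := j) (s := ⟨0, mult_pos hD i⟩)
      (t := ⟨0, mult_pos hD j⟩) h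
  intro i j h A B hAB _
  -- The join and meet of `I i` and `I j` have the same total weight as the pair itself, so
  -- uniqueness forces the pair to be comparable. Both sides of an equation for an incomparable pair
  -- then vanish.
  have hbelow : (I i).Below (I j) := by
    refine ⟨h, fun r => ?_⟩
    have h1 := (key i j _ _ (phi_beta_join_add_meet h (I i) (I j))).2
    calc I i (Fin.castLE h r) ≤ (I i).join h (I j) r := le_max_left _ _
      _ = I j r := by rw [h1]
  have hl : (coordPoint (I i)).rep A * (coordPoint (I j)).rep B = 0 := by
    by_contra hne
    rw [← ne_eq, mul_ne_zero_iff, coordPoint_rep_ne_zero_iff, coordPoint_rep_ne_zero_iff] at hne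
    rw [hne.1, hne.2] at hAB
    exact hAB hbelow
  have hr : (coordPoint (I j)).rep (A.join h B) * (coordPoint (I i)).rep (A.meet B) = 0 := by
    by_contra hne
    rw [← ne_eq, mul_ne_zero_iff, coordPoint_rep_ne_zero_iff, coordPoint_rep_ne_zero_iff] at hne
    have h1 := phi_beta_join_add_meet h A B
    rw [hne.1, hne.2] at h1
    obtain ⟨rfl, rfl⟩ := key i j A B h1.symm
    exact hAB hbelow
  simp only [hl, hr]

theorem corresponds_coordPoint_iff (hD : D.IsWeight lam) {I : ∀ i, PosPath (D.dim i) n}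
    (hz : toReal (D.monomialPoint lam fun i _ => I i) ∈ vertices lam) (p : D.Ambient) :
    D.Corresponds lam p
      (coordPoint ⟨D.monomialPoint lam fun i _ => I i, mem_polytope (monomialPoint_isGCPattern hD _)⟩) ↔
        p = fun i => coordPoint (I i) := by
  constructor
  · rintro ⟨c, hc, h⟩
    have h1 : ∀ i, (p i).rep (I i) ≠ 0 := by
      have h2 := h (fun i _ => I i) ⟨_, mem_polytope (monomialPoint_isGCPattern hD _)⟩ rfl
      have h3 : D.monomialValue lam (fun i _ => I i) p ≠ 0 := by
        intro h0
        rw [h0, mul_zero] at h2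
        exact coordPoint_rep_ne_zero_iff.mpr rfl h2
      exact fun i => (monomialValue_ne_zero_iff _ p).mp h3 i ⟨0, mult_pos hD i⟩
    funext i
    refine eq_coordPoint (p i) fun J hJ => by_contra fun hne => hJ ?_
    -- A second nonzero coordinate `J` would give a monomial that does not vanish at `p`; its
    -- lattice point must be the vertex, whence `J = I i`.
    let g : D.Monomial lam := replaceFactor (fun i _ => I i) i ⟨0, mult_pos hD i⟩ J
    have hg : D.monomialValue lam g p ≠ 0 :=
      (monomialValue_ne_zero_iff _ p).mpr
        (replaceFactor_cases _ _ _ _ (fun i A => (p i).rep A ≠ 0) hne fun i _ => h1 i)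
    have h2 := h g ⟨_, mem_polytope (monomialPoint_isGCPattern hD g)⟩ rfl
    have h3 := coordPoint_rep_ne_zero_iff.mp (h2 ▸ mul_ne_zero hc hg)
    have h4 := monomialPoint_replaceFactor (lam := lam) (fun i _ => I i) i ⟨0, mult_pos hD i⟩ J
    rw [Subtype.mk.injEq] at h3
    rw [h3] at h4
    exact (phi_beta_injective (add_left_cancel h4)).symm
  · rintro rfl
    set χ : LatticePoint lam :=
      ⟨D.monomialPoint lam fun i _ => I i, mem_polytope (monomialPoint_isGCPattern hD _)⟩ with hχ
    have hv : D.monomialValue lam (fun i _ => I i) (fun i => coordPoint (I i)) ≠ 0 :=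
      (monomialValue_ne_zero_iff _ _).mpr fun i _ => coordPoint_rep_ne_zero_iff.mpr rfl
    have hq : (coordPoint χ).rep χ ≠ 0 := coordPoint_rep_ne_zero_iff.mpr rfl
    -- The scalar is fixed by the vertex monomial. Any other monomial vanishes at the point and, by
    -- uniqueness, has a different lattice point.
    refine ⟨(coordPoint χ).rep χ / D.monomialValue lam (fun i _ => I i) (fun i => coordPoint (I i)),
      div_ne_zero hq hv, fun f ψ hf => ?_⟩
    by_cases hfI : f = fun i _ => I i
    · subst hfI
      have : ψ = χ := Subtype.ext hf.symm
      rw [this, div_mul_cancel₀ _ hv]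
    · have h1 : D.monomialValue lam f (fun i => coordPoint (I i)) = 0 := by
        by_contra hne
        exact hfI (funext fun i => funext fun s =>
          coordPoint_rep_ne_zero_iff.mp ((monomialValue_ne_zero_iff _ _).mp hne i s))
      rw [h1, mul_zero]
      by_contra hne
      have h2 : ψ = χ := coordPoint_rep_ne_zero_iff.mp hne
      refine hfI (funext fun i => funext fun s => ?_)
      exact (factor_eq_factor hD hz (by rw [hf, h2]) i s s).symm

theorem toricXFace_of_mem_vertices (hD : D.IsWeight lam) {I : ∀ i, PosPath (D.dim i) n}
    (hz : toReal (D.monomialPoint lam fun i _ => I i) ∈ vertices lam) :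
    D.toricXFace lam {toReal (D.monomialPoint lam fun i _ => I i)} =
      {fun i => coordPoint (I i)} := by
  have h := toricSubvariety_singleton lam
    ⟨D.monomialPoint lam fun i _ => I i, mem_polytope (monomialPoint_isGCPattern hD _)⟩
  ext p
  simp only [FlagType.toricXFace, h, Set.mem_ofPred_eq, Set.mem_singleton_iff, exists_eq_left,
    corresponds_coordPoint_iff hD hz]
  exact ⟨fun h => h.2, fun h => ⟨h ▸ coordPoint_mem_toricX hD hz, h⟩⟩

end Vertex

/-! ### Grassmannians: every coordinate point occurs and lies in `X` -/

section Grassmannian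

variable {m n : ℕ} {hm : 0 < m} {hmn : m < n} {lam : Fin n → ℕ}

theorem grassmannian_monomialPoint_apply (hD : (grassmannian m n hm hmn).IsWeight lam)
    (I : PosPath m n) (p : GCIndex n) :
    (grassmannian m n hm hmn).monomialPoint lam (fun _ _ => I) p = lastMult lam ∨
      (grassmannian m n hm hmn).monomialPoint lam (fun _ _ => I) p = lam ⟨0, by omega⟩ := by
  have h0 : ∀ j : Fin n, lam j ≤ lam ⟨0, by omega⟩ := fun j =>
    hD.antitone (Fin.le_def.mpr (Nat.zero_le _))
  -- At `y = λ_1` every indicator equals 1, so the number of factors plus `λ_n` is `λ_1`.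
  have h1 := sum_indicator_add_lastMult hD (by omega) (lam ⟨0, by omega⟩)
    (by rw [lastMult_eq lam ⟨n - 1, by omega⟩ (by simp only; omega)]; exact_mod_cast h0 _) le_rfl
  have h2 := monomialPoint_apply (grassmannian m n hm hmn) lam (fun _ _ => I) p
  by_cases h : ∃ h : (p.1.2 : ℕ) < m, I ⟨p.1.2, h⟩ ≤ p.1.1
  · refine Or.inr (h2.trans ?_)
    rw [← h1]
    congr 1
    refine Finset.sum_congr rfl fun i _ => Finset.sum_congr rfl fun s _ => ?_
    refine (phi_beta I p).trans ?_
    rw [dif_pos h.1, if_pos h.2, if_pos]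
    have h5 := s.2
    have h6 := h0 ⟨(grassmannian m n hm hmn).dim i - 1,
      lt_of_le_of_lt (Nat.sub_le _ _) ((grassmannian m n hm hmn).dim_lt i)⟩
    simp only [FlagType.mult] at h5
    omega
  · refine Or.inl (h2.trans ?_)
    rw [Finset.sum_eq_zero, zero_add]
    refine fun i _ => Finset.sum_eq_zero fun s _ => ?_
    refine (phi_beta I p).trans ?_
    split_ifs with h3 h4
    · exact absurd ⟨h3, h4⟩ h
    · rfl
    · rfl

/-- All of `Δ` lies in the cube with sides `[λ_n, λ_1]`, and the point is a corner of that cube. -/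
theorem grassmannian_monomialPoint_mem_vertices (hD : (grassmannian m n hm hmn).IsWeight lam)
    (I : PosPath m n) :
    toReal ((grassmannian m n hm hmn).monomialPoint lam fun _ _ => I) ∈ vertices lam := by
  have hsub : polytope lam ⊆
      Set.Icc (fun _ => (lastMult lam : ℝ)) (fun _ => (lam ⟨0, by omega⟩ : ℝ)) := by
    refine convexHull_min ?_ (convex_Icc _ _)
    rintro _ ⟨x, hx, rfl⟩
    refine ⟨fun p => ?_, fun p => ?_⟩
    · have := hx.lastMult_le hD.antitone p
      simp only [toReal]
      exact_mod_cast this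
    · have h1 := hx.le_lam p
      have h2 : (lam p.1.2 : ℤ) ≤ lam ⟨0, by omega⟩ :=
        Int.ofNat_le.mpr (hD.antitone (Fin.le_def.mpr (Nat.zero_le _)))
      simp only [toReal]
      exact_mod_cast h1.trans h2
  refine ⟨mem_polytope (monomialPoint_isGCPattern hD _), ?_⟩
  rintro x hx y hy ⟨a, b, ha, hb, hab, h⟩
  funext p
  have hp := congrFun h p
  have hx' := hsub hx
  have hy' := hsub hy
  have hx1 := hx'.1 p
  have hx2 := hx'.2 p
  have hy1 := hy'.1 p
  have hy2 := hy'.2 p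
  simp only [Pi.add_apply, Pi.smul_apply, smul_eq_mul] at hp hx1 hx2 hy1 hy2
  have hb' : b = 1 - a := by linarith
  subst hb'
  rcases grassmannian_monomialPoint_apply hD I p with hc | hc
  · have hc' : toReal ((grassmannian m n hm hmn).monomialPoint lam fun _ _ => I) p =
        lastMult lam := by
      simp only [toReal, hc]; norm_cast
    rw [hc'] at hp ⊢
    nlinarith [mul_nonneg hb.le (sub_nonneg.mpr hy1), mul_nonneg ha.le (sub_nonneg.mpr hx1)]
  · have hc' : toReal ((grassmannian m n hm hmn).monomialPoint lam fun _ _ => I) p =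
        lam ⟨0, by omega⟩ := by
      simp only [toReal, hc]; norm_cast
    rw [hc'] at hp ⊢
    nlinarith [mul_nonneg hb.le (sub_nonneg.mpr hy2), mul_nonneg ha.le (sub_nonneg.mpr hx2)]

theorem plucker_single_self (I : PosPath m n) :
    plucker (fun r => Pi.single (I r) (1 : ℂ)) I = 1 := by
  unfold plucker
  convert Matrix.det_one (n := Fin m) (R := ℂ)
  ext r s
  simp [Matrix.one_apply, Pi.single_apply, eq_comm]

theorem plucker_single_of_ne {I J : PosPath m n} (h : J ≠ I) :
    plucker (fun r => Pi.single (I r) (1 : ℂ)) J = 0 := by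
  -- Distinct index sets of equal size are not nested, so some column of the minor is zero.
  have hJ : ∃ s, ∀ r, J s ≠ I r := by
    by_contra! hc
    have hsub : Set.range J ⊆ Set.range I := by
      rintro _ ⟨s, rfl⟩
      obtain ⟨r, hr⟩ := hc s
      exact ⟨r, hr.symm⟩
    have hcard : Set.range J = Set.range I := by
      refine Set.eq_of_subset_of_ncard_le hsub ?_ (Set.toFinite _)
      rw [← Set.image_univ, ← Set.image_univ, Set.ncard_image_of_injective _ I.injective,
        Set.ncard_image_of_injective _ J.injective]
    exact h (OrderEmbedding.range_inj.mp hcard)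
  obtain ⟨s, hs⟩ := hJ
  refine Matrix.det_eq_zero_of_column_eq_zero s fun r => ?_
  simp [Pi.single_apply, hs r]

theorem coordPoint_mem_grassmannian (I : PosPath m n) :
    (fun _ => coordPoint I) ∈ (grassmannian m n hm hmn).flagVariety := by
  have hli : LinearIndependent ℂ (fun r => Pi.single (I r) (1 : ℂ) : Fin m → Fin n → ℂ) := by
    have := (Pi.basisFun ℂ (Fin n)).linearIndependent.comp I I.injective
    convert this using 1
    funext r
    simp
  refine ⟨fun _ => Submodule.span ℂ (Set.range fun r => Pi.single (I r) (1 : ℂ)),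
    fun _ _ _ => le_rfl, fun i => ?_, fun i => ⟨fun r => Pi.single (I r) 1, hli, rfl, ?_, ?_⟩⟩
  · rw [finrank_span_eq_card hli, Fintype.card_fin]
    rfl
  · intro h
    exact one_ne_zero ((plucker_single_self I).symm.trans (congrFun h I))
  · exact (mk_eq_coordPoint _ _ fun J hJ => plucker_single_of_ne hJ).symm

end Grassmannian

end GelfandCetlin

open GelfandCetlin in
theorem mainTheorem12 :
    (∀ (m n : ℕ) (hm : 0 < m) (hmn : m < n) (lam : Fin n → ℕ),
      (grassmannian m n hm hmn).IsWeight lam →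
        (∀ z ∈ vertices lam, ∃ q : ℙ ℂ (PosPath m n → ℂ),
          (grassmannian m n hm hmn).toricXFace lam {z} = {fun _ => q}) ∧
        {q : ℙ ℂ (PosPath m n → ℂ) | ∃ z ∈ vertices lam,
          (grassmannian m n hm hmn).toricXFace lam {z} = {fun _ => q}} =
            {q : ℙ ℂ (PosPath m n → ℂ) | IsCoordinatePoint q} ∧
        (grassmannian m n hm hmn).verticesX lam = vertices lam) ∧
    (∀ (k n : ℕ) (D : FlagType k n) (lam : Fin n → ℕ), D.IsWeight lam →
      ∀ z ∈ vertices lam, ∃ p : D.Ambient,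
        D.toricXFace lam {z} = {p} ∧ ∀ i, IsCoordinatePoint (p i)) := by
  refine ⟨fun m n hm hmn lam hD => ?_, fun k n D lam hD z hz => ?_⟩
  · have key : ∀ z ∈ vertices lam, ∃ I : PosPath m n,
        (grassmannian m n hm hmn).toricXFace lam {z} = {fun _ => coordPoint I} := by
      intro z hz
      obtain ⟨I, rfl⟩ := exists_monomialPoint_of_mem_vertices hD hz
      refine ⟨I 0, (toricXFace_of_mem_vertices hD hz).trans ?_⟩
      congr 1
      funext i
      obtain rfl : i = 0 := Subsingleton.elim i 0
      rfl
    refine ⟨fun z hz => ?_, ?_, ?_⟩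
    · obtain ⟨I, hI⟩ := key z hz
      exact ⟨coordPoint I, hI⟩
    · ext q
      rw [Set.mem_ofPred_eq, Set.mem_ofPred_eq, isCoordinatePoint_iff]
      constructor
      · rintro ⟨z, hz, h⟩
        obtain ⟨I, hI⟩ := key z hz
        exact ⟨I, (congrFun (Set.singleton_injective (hI.symm.trans h)) 0).symm⟩
      · rintro ⟨I, rfl⟩
        have hz := grassmannian_monomialPoint_mem_vertices hD I
        exact ⟨_, hz, toricXFace_of_mem_vertices hD (I := fun _ => I) hz⟩
    · ext z
      refine ⟨fun h => h.1, fun hz => ⟨hz, ?_⟩⟩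
      obtain ⟨I, hI⟩ := key z hz
      exact ⟨_, coordPoint_mem_grassmannian I, hI⟩
  · obtain ⟨I, rfl⟩ := exists_monomialPoint_of_mem_vertices hD hz
    exact ⟨_, toricXFace_of_mem_vertices hD hz, fun i => (isCoordinatePoint_iff _).mpr ⟨I i, rfl⟩⟩
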